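/- For every $d\ge 3$, let $\mathcal{D}_d$ be the set of Hausdorff dimensions $\dim_H(\operatorname{supp}(\mu))$ of the supports of Borel probability measures $\mu$ on $[0,1]^d$ all of whose $(d-1)$-dimensional marginals are equal to the Lebesgue measure on $[0,1]^{d-1}$; that is, for every $j\in\{1,\dots,d\}$ the push-forward of $\mu$ under $(x_1,\dots,x_d)\mapsto(x_1,\dots,x_{j-1},x_{j+1},\dots,x_d)$ is the Lebesgue measure on $[0,1]^{d-1}$. Then $\mathcal{D}_d$ is a dense subset of $[d-1,d]$: we have $\mathcal{D}_d\subseteq[d-1,d]$, and every point of $[d-1,d]$ is a limit of elements of $\mathcal{D}_d$. -/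

import Mathlib

open MeasureTheory Set
open scoped ENNReal

/-- The unit cube `[0,1]^ι` as a subset of the Euclidean space `ℝ^ι`. -/
def unitCube (ι : Type*) : Set (EuclideanSpace ℝ ι) :=
  {x | ∀ i, x i ∈ Icc (0 : ℝ) 1}

/-- The Lebesgue measure on `[0,1]^ι`, viewed as a Borel measure on `ℝ^ι`
that is concentrated on the cube. -/
noncomputable def cubeLebesgue (ι : Type*) [Fintype ι] : Measure (EuclideanSpace ℝ ι) :=
  volume.restrict (unitCube ι)

/-- The projection `x ↦ (x_1, …, x_{j-1}, x_{j+1}, …, x_d)` that drops the coordinate `j`. -/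
def dropCoord {d : ℕ} (j : Fin d) (x : EuclideanSpace ℝ (Fin d)) :
    EuclideanSpace ℝ {k : Fin d // k ≠ j} :=
  WithLp.toLp 2 fun k => x k

/-- The Borel probability measures on `[0,1]^d` (that is, the Borel probability measures on `ℝ^d`
that give no mass to the complement of the cube) all of whose `(d-1)`-dimensional marginals
are equal to the Lebesgue measure on the `(d-1)`-dimensional unit cube. -/
def uniformMarginalMeasures (d : ℕ) : Set (Measure (EuclideanSpace ℝ (Fin d))) :=
  {μ | IsProbabilityMeasure μ ∧ μ (unitCube (Fin d))ᶜ = 0 ∧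
    ∀ j : Fin d, μ.map (dropCoord j) = cubeLebesgue {k : Fin d // k ≠ j}}

/-- The set of Hausdorff dimensions of the supports of the measures in
`uniformMarginalMeasures d`. -/
noncomputable def supportDimensions (d : ℕ) : Set ℝ≥0∞ :=
  {s | ∃ μ ∈ uniformMarginalMeasures d, dimH μ.support = s}

/-! For a probability measure `ν` on the circle `ℝ / ℤ`, take a uniform point of the torus and
correct one coordinate so that the sum of all coordinates has law `ν`. Translations of the torus
with zero total sum preserve the resulting law, and they act on any `d - 1` coordinates as all
translations; by uniqueness of Haar measure these marginals are uniform (`map_correctSum_dropped`).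

Let `ν` be the uniform measure on the Cantor set of base-`m` expansions with digits below `k = m ^
s`, where `2 * k ≤ m`. The support lies in a countable union of affine images of (cube of dimension
`d - 1`) × (Cantor set), so its dimension is at most `d - 1 + s` (`dimH_cube_prod_cantor_le`,
`dimH_sum_mem_le`). The mass distribution principle gives equality (`prescribedSumMeasure_le`,
`le_dimH_of_measure_le_geometric`). Powers of two for `k` and `m` realise every rational `s` in `(0,
1)`, which yields density.

Conversely, every admissible support projects onto a set of positive Lebesgue measure in dimension
`d - 1`, which gives the lower bound `d - 1`. -/

/-- The point `0.a₀a₁a₂…` in base `m` whose digits are all smaller than `k`. -/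
noncomputable def cantorPoint {k m : ℕ} (h : k ≤ m) (a : ℕ → Fin k) : ℝ :=
  Real.ofDigits fun i => (a i).castLE h

lemma continuous_cantorPoint {k m : ℕ} (h : k ≤ m) : Continuous (cantorPoint h) := by
  refine Real.continuous_ofDigits.comp (continuous_pi fun i => ?_)
  exact (continuous_of_discreteTopology (f := Fin.castLE h)).comp (continuous_apply i)

lemma cantorPoint_nonneg {k m : ℕ} (h : k ≤ m) (a : ℕ → Fin k) : 0 ≤ cantorPoint h a :=
  Real.ofDigits_nonneg _

/-- Doubling every digit still gives a legitimate base-`m` expansion, whose value is at most `1`. -/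
lemma cantorPoint_le_half {k m : ℕ} (h : k ≤ m) (hkm : 2 * k ≤ m) (a : ℕ → Fin k) :
    cantorPoint h a ≤ 1 / 2 := by
  have key : 2 * cantorPoint h a =
      Real.ofDigits (b := m) fun i => ⟨2 * (a i : ℕ), by have := (a i).2; omega⟩ := by
    rw [cantorPoint, Real.ofDigits, Real.ofDigits, ← Real.summable_ofDigitsTerm.tsum_mul_left]
    congr 1
    ext i
    simp [Real.ofDigitsTerm, mul_assoc]
  have := Real.ofDigits_le_one (b := m) fun i => ⟨2 * (a i : ℕ), by have := (a i).2; omega⟩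
  linarith

lemma abs_cantorPoint_sub_le_half {k m : ℕ} (h : k ≤ m) (hkm : 2 * k ≤ m) (a b : ℕ → Fin k) :
    |cantorPoint h a - cantorPoint h b| ≤ 1 / 2 := by
  have h1 := cantorPoint_nonneg h a
  have h2 := cantorPoint_nonneg h b
  have h3 := cantorPoint_le_half h hkm a
  have h4 := cantorPoint_le_half h hkm b
  rw [abs_le]
  constructor <;> linarith

lemma mul_cantorPoint {k m : ℕ} (h : k ≤ m) (hm : 0 < m) (a : ℕ → Fin k) :
    (m : ℝ) * cantorPoint h a = (a 0 : ℕ) + cantorPoint h fun i => a (i + 1) := by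
  have hm' : (m : ℝ) ≠ 0 := by positivity
  rw [cantorPoint, Real.ofDigits_eq_sum_add_ofDigits _ 1]
  simp only [Finset.range_one, Finset.sum_singleton, Real.ofDigitsTerm, cantorPoint]
  simp
  field_simp

/-- Multiplication by `m` splits off the first digits. The tails differ by at most `1 / 2` and the
scaled points by less than `1 / 2`, so the first digits differ by an integer of absolute value below
`1`; induct on the tails. -/
lemma digits_eq_of_abs_cantorPoint_sub_lt {k m : ℕ} (h : k ≤ m) (hk : 0 < k) (hkm : 2 * k ≤ m)
    (n : ℕ) (a b : ℕ → Fin k)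
    (hab : |cantorPoint h a - cantorPoint h b| < ((2 : ℝ) * m ^ n)⁻¹) :
    ∀ i < n, a i = b i := by
  induction n generalizing a b with
  | zero => simp
  | succ n ih =>
    have hm : 0 < m := by omega
    have hm1 : (1 : ℝ) ≤ m := by exact_mod_cast hm
    have hmul := mul_cantorPoint h hm a
    have hmul' := mul_cantorPoint h hm b
    set x := cantorPoint h fun i => a (i + 1) with hx
    set y := cantorPoint h fun i => b (i + 1) with hy
    have hxy : |x - y| ≤ 1 / 2 := abs_cantorPoint_sub_le_half h hkm _ _
    have h1 : |((a 0 : ℕ) : ℝ) - (b 0 : ℕ) + (x - y)| < ((2 : ℝ) * m ^ n)⁻¹ := by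
      have : ((a 0 : ℕ) : ℝ) - (b 0 : ℕ) + (x - y) =
          m * (cantorPoint h a - cantorPoint h b) := by
        rw [mul_sub, hmul, hmul']; ring
      rw [this, abs_mul, abs_of_nonneg (by positivity)]
      calc (m : ℝ) * |cantorPoint h a - cantorPoint h b| < m * ((2 : ℝ) * m ^ (n + 1))⁻¹ := by
            gcongr
        _ = ((2 : ℝ) * m ^ n)⁻¹ := by field_simp; rw [pow_succ']
    have h2 : ((2 : ℝ) * m ^ n)⁻¹ ≤ 1 / 2 := by
      rw [one_div]
      apply inv_anti₀ (by norm_num)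
      have : (1 : ℝ) ≤ m ^ n := one_le_pow₀ hm1
      linarith
    have h0 : a 0 = b 0 := by
      have h3 : |((a 0 : ℕ) : ℝ) - (b 0 : ℕ)| < 1 := by
        have := abs_sub_abs_le_abs_sub (((a 0 : ℕ) : ℝ) - (b 0 : ℕ)) (-(x - y))
        rw [abs_neg, sub_neg_eq_add] at this
        linarith
      have h4 : |((a 0 : ℕ) : ℤ) - (b 0 : ℕ)| < 1 := by exact_mod_cast h3
      rw [Int.abs_lt_one_iff] at h4
      apply Fin.ext
      omega
    rw [h0, sub_self, zero_add] at h1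
    intro i hi
    cases i with
    | zero => exact h0
    | succ i => exact ih _ _ h1 i (by omega)

/-! ### The uniform measure on a Cantor set and its mass on small balls -/

/-- The uniform probability measure on sequences of digits smaller than `k`. -/
noncomputable def digitMeasure (k : ℕ) [NeZero k] : Measure (ℕ → Fin k) :=
  Measure.infinitePi fun _ => (PMF.uniformOfFintype (Fin k)).toMeasure

instance (k : ℕ) [NeZero k] : IsProbabilityMeasure (digitMeasure k) := by
  unfold digitMeasure; infer_instance

lemma digitMeasure_cylinder (k : ℕ) [NeZero k] (n : ℕ) (a : ℕ → Fin k) :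
    digitMeasure k {b | ∀ i < n, b i = a i} = ((k : ℝ≥0∞)⁻¹) ^ n := by
  have : {b : ℕ → Fin k | ∀ i < n, b i = a i} =
      Set.pi (Finset.range n) fun i => {a i} := by
    ext b; simp [Set.mem_pi]
  rw [this, digitMeasure, Measure.infinitePi_pi _ (fun i _ => measurableSet_singleton _)]
  simp

/-- The image on the circle `ℝ / ℤ` of the uniform measure on a Cantor set. -/
noncomputable def cantorCircleMeasure {k m : ℕ} [NeZero k] (h : k ≤ m) : Measure UnitAddCircle :=
  (digitMeasure k).map fun a => (cantorPoint h a : UnitAddCircle)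

lemma continuous_coe_cantorPoint {k m : ℕ} (h : k ≤ m) :
    Continuous fun a => (cantorPoint h a : UnitAddCircle) :=
  (AddCircle.continuous_mk' 1).comp (continuous_cantorPoint h)

instance {k m : ℕ} [NeZero k] (h : k ≤ m) : IsProbabilityMeasure (cantorCircleMeasure h) :=
  Measure.isProbabilityMeasure_map (continuous_coe_cantorPoint h).measurable.aemeasurable

/-- The ball is too small to meet two cylinders of level `n`. Differences of Cantor points are at
most `1 / 2`, so circle distance equals distance on the line and no wrap-around occurs. -/
lemma cantorCircleMeasure_closedBall_le {k m : ℕ} [NeZero k] (h : k ≤ m) (hkm : 2 * k ≤ m)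
    (n : ℕ) (v : UnitAddCircle) {r : ℝ} (hr : 2 * r < ((2 : ℝ) * m ^ n)⁻¹) :
    cantorCircleMeasure h (Metric.closedBall v r) ≤ ((k : ℝ≥0∞)⁻¹) ^ n := by
  rw [cantorCircleMeasure, Measure.map_apply (continuous_coe_cantorPoint h).measurable
    Metric.isClosed_closedBall.measurableSet]
  rcases eq_empty_or_nonempty
    ((fun a => (cantorPoint h a : UnitAddCircle)) ⁻¹' Metric.closedBall v r) with he | ⟨b, hb⟩
  · simp [he]
  rw [← digitMeasure_cylinder k n b]
  refine measure_mono fun a ha => ?_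
  refine digits_eq_of_abs_cantorPoint_sub_lt h (NeZero.pos k) hkm n a b (lt_of_le_of_lt ?_ hr)
  have h1 : ‖((cantorPoint h a - cantorPoint h b : ℝ) : UnitAddCircle)‖ =
      |cantorPoint h a - cantorPoint h b| := by
    rw [AddCircle.norm_coe_eq_abs_iff 1 one_ne_zero, abs_one]
    exact abs_cantorPoint_sub_le_half h hkm a b
  rw [← h1, AddCircle.coe_sub, ← dist_eq_norm]
  simp only [mem_preimage, Metric.mem_closedBall] at ha hb
  linarith [dist_triangle_right (cantorPoint h a : UnitAddCircle) (cantorPoint h b) v]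

/-! ### Upper bound for the dimension of cube × Cantor set -/

lemma cylinder_image_ediam_le {k m : ℕ} (h : k ≤ m) (n : ℕ) (w : Fin n → Fin k) :
    Metric.ediam (cantorPoint h '' {a | ∀ i : Fin n, a i = w i}) ≤
      ENNReal.ofReal ((m : ℝ) ^ n)⁻¹ := by
  refine Metric.ediam_le ?_
  rintro _ ⟨a, ha, rfl⟩ _ ⟨b, hb, rfl⟩
  rw [edist_dist, Real.dist_eq]
  refine ENNReal.ofReal_le_ofReal (Real.abs_ofDigits_sub_ofDigits_le fun i hi => ?_)
  rw [Set.mem_ofPred_eq] at ha hb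
  have h1 := ha ⟨i, hi⟩
  have h2 := hb ⟨i, hi⟩
  simp_all

lemma exists_fin_mem_Icc_div {N : ℕ} (hN : 0 < N) {x : ℝ} (hx : x ∈ Icc (0 : ℝ) 1) :
    ∃ j : Fin N, x ∈ Icc ((j : ℝ) / N) ((j + 1 : ℝ) / N) := by
  have hN' : (0 : ℝ) < N := by exact_mod_cast hN
  -- The endpoint `x = 1` has floor `N`, outside `Fin N`, so it is put in the last cell.
  rcases hx.2.eq_or_lt with rfl | h1
  · refine ⟨⟨N - 1, by omega⟩, ?_, ?_⟩
    · rw [div_le_one hN']; exact_mod_cast Nat.sub_le N 1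
    · rw [le_div_iff₀ hN', one_mul]
      have : N = N - 1 + 1 := by omega
      exact_mod_cast this.le
  · have h0 : 0 ≤ x * N := mul_nonneg hx.1 hN'.le
    refine ⟨⟨⌊x * N⌋₊, ?_⟩, ?_, ?_⟩
    · rw [Nat.floor_lt h0]; nlinarith
    · rw [div_le_iff₀ hN']; exact Nat.floor_le h0
    · rw [le_div_iff₀ hN']; exact (Nat.lt_floor_add_one _).le

/-- At level `n`, `m ^ (n * card ι) * k ^ n` boxes of diameter at most `m ^ (-n)` cover the product.
Since `k = m ^ s`, the bound on the sum of the `t`-th powers of the diameters is exactly `1` at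
every level. -/
lemma dimH_cube_prod_cantor_le {ι : Type*} [Fintype ι] {k m : ℕ} (h : k ≤ m) (hm : 2 ≤ m)
    {s : ℝ} (hs : 0 ≤ s) (hks : (k : ℝ) = (m : ℝ) ^ s) :
    dimH ((univ.pi fun _ : ι => Icc (0 : ℝ) 1) ×ˢ range (cantorPoint h)) ≤
      ENNReal.ofReal (Fintype.card ι + s) := by
  classical
  have hm0 : (0 : ℝ) < m := by positivity
  have hm1 : (1 : ℝ) < m := by exact_mod_cast hm
  set t : ℝ := Fintype.card ι + s with ht
  have ht0 : 0 ≤ t := by positivity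
  have key : μH[t] ((univ.pi fun _ : ι => Icc (0 : ℝ) 1) ×ˢ range (cantorPoint h)) ≤ 1 := by
    let c : ∀ n : ℕ, (ι → Fin (m ^ n)) × (Fin n → Fin k) → Set ((ι → ℝ) × ℝ) := fun n p =>
      (univ.pi fun i => Icc (((p.1 i : ℕ) : ℝ) / (m ^ n : ℕ)) (((p.1 i : ℕ) + 1 : ℝ) / (m ^ n : ℕ)))
        ×ˢ (cantorPoint h '' {a | ∀ i : Fin n, a i = p.2 i})
    have hdiam : ∀ n p, Metric.ediam (c n p) ≤ ENNReal.ofReal ((m : ℝ) ^ n)⁻¹ := by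
      rintro n ⟨p, w⟩
      refine Metric.ediam_le ?_
      rintro ⟨x, y⟩ ⟨hx, hy⟩ ⟨x', y'⟩ ⟨hx', hy'⟩
      rw [Prod.edist_eq]
      refine max_le (edist_pi_le_iff.2 fun i => ?_)
        ((Metric.edist_le_ediam_of_mem hy hy').trans (cylinder_image_ediam_le h n w))
      rw [edist_dist]
      refine ENNReal.ofReal_le_ofReal ((Real.dist_le_of_mem_Icc (hx i trivial)
        (hx' i trivial)).trans (le_of_eq ?_))
      push_cast
      field_simp
      ring
    have hcover : ∀ n, ((univ.pi fun _ : ι => Icc (0 : ℝ) 1) ×ˢ range (cantorPoint h)) ⊆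
        ⋃ p, c n p := by
      rintro n ⟨x, y⟩ ⟨hx, a, rfl⟩
      choose p hp using fun i => exists_fin_mem_Icc_div (N := m ^ n) (by positivity) (hx i trivial)
      exact mem_iUnion.2 ⟨(p, fun i => a i), fun i _ => hp i, a, fun _ => rfl, rfl⟩
    have hr : Filter.Tendsto (fun n : ℕ => ENNReal.ofReal ((m : ℝ) ^ n)⁻¹) Filter.atTop (nhds 0) := by
      rw [← ENNReal.ofReal_zero]
      refine ENNReal.tendsto_ofReal ?_
      exact (tendsto_pow_atTop_atTop_of_one_lt hm1).inv_tendsto_atTop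
    refine (Measure.hausdorffMeasure_le_liminf_sum t _ _ hr c (.of_forall hdiam)
      (.of_forall hcover)).trans ?_
    refine Filter.liminf_le_of_frequently_le' (Filter.Frequently.of_forall fun n => ?_)
    calc ∑ p, Metric.ediam (c n p) ^ t
        ≤ ∑ p : (ι → Fin (m ^ n)) × (Fin n → Fin k), ENNReal.ofReal ((m : ℝ) ^ n)⁻¹ ^ t := by
          gcongr with p _
          exact hdiam n p
      _ = 1 := by
          rw [Finset.sum_const, nsmul_eq_mul, ENNReal.ofReal_rpow_of_nonneg (by positivity) ht0,
            ← ENNReal.ofReal_natCast, ← ENNReal.ofReal_mul (by positivity), ← ENNReal.ofReal_one]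
          congr 1
          simp only [Finset.card_univ, Fintype.card_prod, Fintype.card_pi, Fintype.card_fin,
            Finset.prod_const, Nat.cast_mul, Nat.cast_pow]
          rw [ht, Real.rpow_add (by positivity), Real.rpow_natCast, hks,
            Real.inv_rpow (by positivity), ← Real.rpow_natCast (_ ^ s), ← Real.rpow_natCast (m : ℝ) n,
            ← Real.rpow_mul hm0.le, ← Real.rpow_mul hm0.le, mul_comm s]
          field_simp
          rw [← mul_pow, mul_one_div_cancel (by positivity), one_pow]
  have := dimH_le_of_hausdorffMeasure_ne_top (d := t.toNNReal)
    (s := (univ.pi fun _ : ι => Icc (0 : ℝ) 1) ×ˢ range (cantorPoint h)) (by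
      rw [Real.coe_toNNReal _ ht0]
      exact (key.trans_lt ENNReal.one_lt_top).ne)
  exact this

/-! ### Lower bounds for dimension from mass estimates -/

/-- The mass distribution principle, along a geometric sequence of scales. -/
lemma le_dimH_of_measure_le_geometric {X : Type*} [MetricSpace X] [MeasurableSpace X]
    [BorelSpace X] (μ : Measure X) {b c t : ℝ} (hb : 1 < b) (hc : 0 < c) (ht : 0 < t)
    (h : ∀ (n : ℕ) (U : Set X), IsClosed U → Metric.ediam U ≤ ENNReal.ofReal (c / b ^ n) →
      μ U ≤ ENNReal.ofReal ((b ^ n)⁻¹ ^ t))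
    {S : Set X} (hS : μ S ≠ 0) : ENNReal.ofReal t ≤ dimH S := by
  have hb0 : 0 < b := by linarith
  -- If `n` is the last scale with `δ ≤ c / b ^ n`, then `(c / b) * (b ^ n)⁻¹ < δ`; this is where
  -- the factor `c / b` comes from.
  set C : ℝ := (c / b) ^ t with hC
  have hC0 : 0 < C := by positivity
  have hle : ENNReal.ofReal C • μ ≤ μH[t] := by
    refine Measure.le_hausdorffMeasure t _ (ENNReal.ofReal c) (by simpa using hc) fun U hU => ?_
    rw [← Metric.ediam_closure]
    refine (measure_mono subset_closure).trans ?_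
    rw [← Metric.ediam_closure] at hU
    generalize hV : closure U = V at hU
    have hVc : IsClosed V := hV ▸ isClosed_closure
    have htop : Metric.ediam V ≠ ⊤ := (hU.trans_lt ENNReal.ofReal_lt_top).ne
    rw [Measure.smul_apply, smul_eq_mul]
    obtain ⟨δ, hδ0, hδ⟩ : ∃ δ : ℝ, 0 ≤ δ ∧ Metric.ediam V = ENNReal.ofReal δ :=
      ⟨_, ENNReal.toReal_nonneg, (ENNReal.ofReal_toReal htop).symm⟩
    rw [hδ] at hU ⊢
    rw [ENNReal.ofReal_le_ofReal_iff hc.le] at hU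
    -- A set of diameter zero has no last scale; it is null because the bound holds at all scales.
    rcases hδ0.eq_or_lt with rfl | hδ0
    · have hz : μ V ≤ 0 := by
        refine ge_of_tendsto' (x := Filter.atTop)
          (f := fun n : ℕ => ENNReal.ofReal ((b ^ n)⁻¹ ^ t)) ?_ fun n => h n V hVc ?_
        · rw [← ENNReal.ofReal_zero]
          refine ENNReal.tendsto_ofReal ?_
          have h1 := (tendsto_pow_atTop_atTop_of_one_lt hb).inv_tendsto_atTop
          have h2 := h1.rpow_const (p := t) (Or.inr ht.le)
          rwa [Real.zero_rpow ht.ne'] at h2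
        · rw [hδ]
          exact ENNReal.ofReal_le_ofReal (by positivity)
      simp [nonpos_iff_eq_zero.1 hz]
    · obtain ⟨n, hn1, hn2⟩ := exists_nat_pow_near ((one_le_div hδ0).2 hU) hb
      have h1 : δ ≤ c / b ^ n := by
        rw [le_div_iff₀ (by positivity)]
        rw [le_div_iff₀ hδ0] at hn1
        linarith
      refine (mul_le_mul_right (h n V hVc (hδ ▸ ENNReal.ofReal_le_ofReal h1)) _).trans ?_
      rw [ENNReal.ofReal_rpow_of_pos hδ0, ← ENNReal.ofReal_mul hC0.le, hC,
        ← Real.mul_rpow (by positivity) (by positivity)]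
      refine ENNReal.ofReal_le_ofReal (Real.rpow_le_rpow (by positivity) ?_ ht.le)
      rw [div_lt_iff₀ hδ0] at hn2
      rw [div_mul_eq_mul_div, ← div_eq_mul_inv, div_div, div_le_iff₀ (by positivity)]
      rw [pow_succ] at hn2
      linarith
  have hpos : μH[t] S ≠ 0 := by
    intro h0
    have := hle S
    rw [h0, Measure.smul_apply, smul_eq_mul, nonpos_iff_eq_zero, mul_eq_zero] at this
    rcases this with h1 | h1
    · rw [ENNReal.ofReal_eq_zero] at h1; linarith
    · exact hS h1
  refine le_dimH_of_hausdorffMeasure_ne_zero (d := t.toNNReal) ?_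
  rwa [Real.coe_toNNReal _ ht.le]

/-! ### Lifting the circle and the torus to the cube -/

section Circle

/-- The representative in `(0, 1]` of a point of the circle `ℝ / ℤ`. -/
noncomputable def circleRep (x : UnitAddCircle) : ℝ :=
  (AddCircle.equivIoc 1 0 x : ℝ)

lemma circleRep_mem (x : UnitAddCircle) : circleRep x ∈ Ioc (0 : ℝ) 1 := by
  have h := (AddCircle.equivIoc 1 0 x).2
  simp only [zero_add] at h
  exact h

lemma coe_circleRep (x : UnitAddCircle) : (circleRep x : UnitAddCircle) = x :=
  (AddCircle.equivIoc 1 0).symm_apply_apply x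

lemma measurePreserving_circleRep :
    MeasurePreserving circleRep volume (volume.restrict (Ioc (0 : ℝ) 1)) := by
  have h := AddCircle.measurePreserving_equivIoc (T := 1) (a := 0)
  have h2 := measurePreserving_subtype_coe (μa := (volume : Measure ℝ))
    (measurableSet_Ioc (a := (0 : ℝ)) (b := 0 + 1))
  have h3 : MeasurePreserving circleRep volume (volume.restrict (Ioc (0 : ℝ) (0 + 1))) := h2.comp h
  rwa [zero_add] at h3

instance isProbabilityMeasure_volume_unitAddCircle :
    IsProbabilityMeasure (volume : Measure UnitAddCircle) :=
  ⟨UnitAddCircle.measure_univ⟩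

end Circle

section Torus

variable {ι : Type*}

lemma isClosed_unitCube : IsClosed (unitCube ι) := by
  have : unitCube ι = ⋂ i, {x | x i ∈ Icc (0 : ℝ) 1} := by ext; simp [unitCube]
  rw [this]
  exact isClosed_iInter fun i => isClosed_Icc.preimage (by fun_prop)

/-- The lift of a point of the torus `(ℝ / ℤ)^ι` to the half-open cube `(0, 1]^ι`. -/
noncomputable def torusLift (x : ι → UnitAddCircle) : EuclideanSpace ℝ ι :=
  WithLp.toLp 2 fun i => circleRep (x i)

lemma measurePreserving_torusLift [Fintype ι] :
    MeasurePreserving (torusLift (ι := ι)) volume (cubeLebesgue ι) := by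
  have h1 : MeasurePreserving (fun (x : ι → UnitAddCircle) i => circleRep (x i)) volume
      (Measure.pi fun _ => volume.restrict (Ioc (0 : ℝ) 1)) :=
    measurePreserving_pi _ _ fun _ => measurePreserving_circleRep
  rw [← Measure.restrict_pi_pi] at h1
  have h2 := (PiLp.volume_preserving_toLp ι).restrict_preimage
    (isClosed_unitCube (ι := ι)).measurableSet
  have h3 : (WithLp.toLp 2 ⁻¹' unitCube ι : Set (ι → ℝ)) = univ.pi fun _ => Icc (0 : ℝ) 1 := by
    ext; simp only [unitCube, Set.mem_pi, mem_univ, true_imp_iff]; rfl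
  rw [h3] at h2
  have h4 : (Measure.pi fun _ : ι => (volume : Measure ℝ)).restrict (univ.pi fun _ => Ioc (0 : ℝ) 1) =
      volume.restrict (univ.pi fun _ => Icc (0 : ℝ) 1) :=
    Measure.restrict_congr_set (Measure.ae_eq_set_pi fun _ _ => Ioc_ae_eq_Icc)
  rw [h4] at h1
  exact h2.comp h1

lemma torusLift_mem_unitCube (x : ι → UnitAddCircle) : torusLift x ∈ unitCube ι :=
  fun i => Ioc_subset_Icc_self (circleRep_mem (x i))

lemma coe_torusLift (x : ι → UnitAddCircle) (i : ι) : (torusLift x i : UnitAddCircle) = x i :=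
  coe_circleRep _

lemma isClosed_sum_mem [Fintype ι] {K : Set UnitAddCircle} (hK : IsClosed K) :
    IsClosed {x : EuclideanSpace ℝ ι | ((∑ i, x i : ℝ) : UnitAddCircle) ∈ K} :=
  hK.preimage ((AddCircle.continuous_mk' 1).comp (by fun_prop))

variable [Fintype ι] [DecidableEq ι]

/-- A coordinate sum congruent to `c` modulo `1` equals `c + n` for an integer `n`. Solving for the
coordinate `i₀` writes the set inside countably many affine images of cube × `C`. -/
lemma dimH_sum_mem_le (i₀ : ι) {s : ℝ≥0∞} {C : Set ℝ}
    (hC : dimH ((univ.pi fun _ : {k // k ≠ i₀} => Icc (0 : ℝ) 1) ×ˢ C) ≤ s) :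
    dimH (unitCube ι ∩ {x | ((∑ i, x i : ℝ) : UnitAddCircle) ∈ (fun c : ℝ => (c : UnitAddCircle)) '' C})
      ≤ s := by
  let g : ℤ → ({k // k ≠ i₀} → ℝ) × ℝ → EuclideanSpace ℝ ι := fun n p =>
    WithLp.toLp 2 fun i => if h : i = i₀ then p.2 + n - ∑ k, p.1 k else p.1 ⟨i, h⟩
  have hg : ∀ n, ContDiff ℝ 1 (g n) := by
    intro n
    rw [contDiff_piLp]
    intro i
    by_cases h : i = i₀
    · simp only [g, h, dite_true]
      fun_prop
    · simp only [g, h, dite_false]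
      fun_prop
  have hsub : (unitCube ι ∩ {x | ((∑ i, x i : ℝ) : UnitAddCircle) ∈
      (fun c : ℝ => (c : UnitAddCircle)) '' C}) ⊆
      ⋃ n : ℤ, g n '' ((univ.pi fun _ : {k // k ≠ i₀} => Icc (0 : ℝ) 1) ×ˢ C) := by
    rintro x ⟨hx, c, hc, hcx⟩
    obtain ⟨n, hn⟩ : ∃ n : ℤ, n • (1 : ℝ) = ∑ i, x i - c := by
      rw [← AddCircle.coe_eq_zero_iff, AddCircle.coe_sub, sub_eq_zero]
      exact hcx.symm
    rw [zsmul_one] at hn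
    refine mem_iUnion.2 ⟨n, (fun k => x k, c), ⟨fun k _ => hx k, hc⟩, ?_⟩
    refine Eq.symm ?_
    ext i
    by_cases h : i = i₀
    · subst h
      simp only [g, dite_true]
      have := Fintype.sum_eq_add_sum_subtype_ne (fun i => x i) i
      change x i = c + n - ∑ k : {k // k ≠ i}, x k
      linarith
    · simp [g, h]
  refine (dimH_mono hsub).trans ?_
  rw [dimH_iUnion]
  refine iSup_le fun n => le_trans ?_ hC
  exact (hg n).contDiffOn.dimH_image_le convex_univ (subset_univ _)

/-! ### Measures with uniform marginals and prescribed law of the sum -/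

/-- The point with coordinate sum `p.2` obtained by correcting the coordinate `i₀` of `p.1`. -/
def correctSum (i₀ : ι) (p : (ι → UnitAddCircle) × UnitAddCircle) : ι → UnitAddCircle :=
  p.1 + Pi.single i₀ (p.2 - ∑ i, p.1 i)

lemma continuous_correctSum (i₀ : ι) : Continuous (correctSum i₀) := by
  unfold correctSum
  refine continuous_fst.add ((continuous_single i₀).comp ?_)
  fun_prop

lemma sum_correctSum (i₀ : ι) (p : (ι → UnitAddCircle) × UnitAddCircle) :
    ∑ i, correctSum i₀ p i = p.2 := by
  simp [correctSum, Finset.sum_add_distrib]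

lemma correctSum_of_ne {i₀ i : ι} (h : i ≠ i₀) (p : (ι → UnitAddCircle) × UnitAddCircle) :
    correctSum i₀ p i = p.1 i := by
  simp [correctSum, h]

lemma correctSum_add (i₀ : ι) {h : ι → UnitAddCircle} (hh : ∑ i, h i = 0)
    (p : (ι → UnitAddCircle) × UnitAddCircle) :
    correctSum i₀ (h + p.1, p.2) = h + correctSum i₀ p := by
  simp [correctSum, Finset.sum_add_distrib, hh, add_assoc]

/-- The coordinate `j` absorbs the sum, so every translation of the remaining coordinates lifts to
one that keeps the total sum. -/
lemma exists_sum_eq_zero_extension (j : ι) (g : {k // k ≠ j} → UnitAddCircle) :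
    ∃ h : ι → UnitAddCircle, ∑ i, h i = 0 ∧ ∀ k : {k // k ≠ j}, h k = g k := by
  let e : ι → UnitAddCircle := fun i => if hi : i ≠ j then g ⟨i, hi⟩ else 0
  refine ⟨e + Pi.single j (-∑ i, e i), by simp [Finset.sum_add_distrib], fun k => ?_⟩
  have := k.2
  simp [e, this]

lemma map_correctSum_dropped (i₀ j : ι) (ν : Measure UnitAddCircle) [IsProbabilityMeasure ν] :
    (((volume : Measure (ι → UnitAddCircle)).prod ν).map
      fun p (k : {k // k ≠ j}) => correctSum i₀ p k) = volume := by
  have hc : Continuous fun (p : (ι → UnitAddCircle) × UnitAddCircle) (k : {k // k ≠ j}) =>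
      correctSum i₀ p k :=
    continuous_pi fun k => (continuous_apply _).comp (continuous_correctSum i₀)
  set P := ((volume : Measure (ι → UnitAddCircle)).prod ν).map
      fun p (k : {k // k ≠ j}) => correctSum i₀ p k with hP
  have : IsProbabilityMeasure P := Measure.isProbabilityMeasure_map hc.measurable.aemeasurable
  have : P.IsAddLeftInvariant := by
    refine ⟨fun g => ?_⟩
    obtain ⟨h, h0, hg⟩ := exists_sum_eq_zero_extension j g
    have hmp : MeasurePreserving (fun p : (ι → UnitAddCircle) × UnitAddCircle => (h + p.1, p.2))
        ((volume : Measure (ι → UnitAddCircle)).prod ν) (volume.prod ν) :=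
      (measurePreserving_add_left volume h).prod (MeasurePreserving.id ν)
    rw [hP, Measure.map_map (measurable_const_add g) hc.measurable]
    conv_rhs => rw [← hmp.map_eq, Measure.map_map hc.measurable hmp.measurable]
    congr 1
    ext p k
    simp [correctSum_add i₀ h0, hg]
  have : P.IsAddHaarMeasure := Measure.isAddHaarMeasure_of_isCompact_nonempty_interior P univ
    isCompact_univ (by simp) (by simp) (by simp)
  exact Measure.isAddHaarMeasure_eq_of_isProbabilityMeasure P volume

/-- The law of a uniformly distributed random point of the cube conditioned on the sum of its
coordinates having law `ν` modulo `1`. -/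
noncomputable def prescribedSumMeasure (i₀ : ι) (ν : Measure UnitAddCircle) :
    Measure (EuclideanSpace ℝ ι) :=
  ((volume : Measure (ι → UnitAddCircle)).prod ν).map fun p => torusLift (correctSum i₀ p)

lemma measurable_torusLift_correctSum (i₀ : ι) :
    Measurable fun p => torusLift (correctSum i₀ p) :=
  measurePreserving_torusLift.measurable.comp (continuous_correctSum i₀).measurable

instance (i₀ : ι) (ν : Measure UnitAddCircle) [IsProbabilityMeasure ν] :
    IsProbabilityMeasure (prescribedSumMeasure i₀ ν) :=
  Measure.isProbabilityMeasure_map (measurable_torusLift_correctSum i₀).aemeasurable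

lemma prescribedSumMeasure_compl_unitCube (i₀ : ι) (ν : Measure UnitAddCircle) :
    prescribedSumMeasure i₀ ν (unitCube ι)ᶜ = 0 := by
  rw [prescribedSumMeasure, Measure.map_apply (measurable_torusLift_correctSum i₀)
    isClosed_unitCube.measurableSet.compl]
  rw [preimage_compl, preimage_eq_univ_iff.2 (range_subset_iff.2 fun p => torusLift_mem_unitCube _),
    compl_univ, measure_empty]

lemma prescribedSumMeasure_sum_notMem (i₀ : ι) (ν : Measure UnitAddCircle)
    [IsProbabilityMeasure ν] {K : Set UnitAddCircle} (hK : IsClosed K) (hν : ν Kᶜ = 0) :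
    prescribedSumMeasure i₀ ν
      {x : EuclideanSpace ℝ ι | ((∑ i, x i : ℝ) : UnitAddCircle) ∈ K}ᶜ = 0 := by
  rw [prescribedSumMeasure, Measure.map_apply (measurable_torusLift_correctSum i₀)
    (isClosed_sum_mem hK).measurableSet.compl]
  have : ((fun p => torusLift (correctSum i₀ p)) ⁻¹'
      {x : EuclideanSpace ℝ ι | ((∑ i, x i : ℝ) : UnitAddCircle) ∈ K}ᶜ) = univ ×ˢ Kᶜ := by
    ext p
    have : ((∑ i, torusLift (correctSum i₀ p) i : ℝ) : UnitAddCircle) = p.2 := by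
      rw [← sum_correctSum i₀ p]
      refine (map_sum (QuotientAddGroup.mk' (AddSubgroup.zmultiples (1 : ℝ))) _ _).trans ?_
      exact Finset.sum_congr rfl fun i _ => coe_torusLift _ i
    simp only [mem_preimage, mem_compl_iff, Set.mem_ofPred_eq, this, mem_prod, mem_univ, true_and]
  rw [this, Measure.prod_prod, hν, mul_zero]

/-- Each coordinate other than `i₀` is confined to an arc of length at most `2 * δ`, and the sum to
a ball of radius `card ι * δ`. The coordinate `i₀` of `p.1` is overwritten by `correctSum`, so it
contributes a factor `1`. -/
lemma prescribedSumMeasure_le (i₀ : ι) (ν : Measure UnitAddCircle) [IsProbabilityMeasure ν]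
    {q : ℝ≥0∞} {δ : ℝ} (hδ : 0 ≤ δ)
    (hν : ∀ v, ν (Metric.closedBall v (Fintype.card ι * δ)) ≤ q)
    {U : Set (EuclideanSpace ℝ ι)} (hU : IsClosed U) (hUδ : Metric.ediam U ≤ ENNReal.ofReal δ) :
    prescribedSumMeasure i₀ ν U ≤ ENNReal.ofReal (2 * δ) ^ (Fintype.card ι - 1) * q := by
  rcases U.eq_empty_or_nonempty with rfl | ⟨u, hu⟩
  · simp
  rw [prescribedSumMeasure, Measure.map_apply (measurable_torusLift_correctSum i₀)
    hU.measurableSet]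
  have hsub : (fun p => torusLift (correctSum i₀ p)) ⁻¹' U ⊆
      (univ.pi fun i => if i = i₀ then univ else Metric.closedBall (u i : UnitAddCircle) δ) ×ˢ
        Metric.closedBall (∑ i, (u i : UnitAddCircle)) (Fintype.card ι * δ) := by
    intro p hp
    have hi : ∀ i, dist (correctSum i₀ p i) (u i : UnitAddCircle) ≤ δ := by
      intro i
      have h1 : dist (torusLift (correctSum i₀ p)) u ≤ δ := by
        have := (Metric.edist_le_ediam_of_mem (mem_preimage.1 hp) hu).trans hUδ
        rwa [edist_dist, ENNReal.ofReal_le_ofReal_iff hδ] at this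
      have h2 := (PiLp.norm_apply_le (torusLift (correctSum i₀ p) - u) i).trans
        ((dist_eq_norm _ u).symm.trans_le h1)
      rw [← coe_torusLift (correctSum i₀ p) i, dist_eq_norm, ← AddCircle.coe_sub]
      refine le_trans ?_ h2
      -- The circle norm is the distance to the nearest integer, hence at most the distance to `0`.
      rw [UnitAddCircle.norm_eq]
      exact (round_le _ 0).trans (by simp)
    refine ⟨fun i _ => ?_, ?_⟩
    · by_cases h : i = i₀
      · simp [h]
      · simpa [h, ← correctSum_of_ne h] using hi i
    · rw [Metric.mem_closedBall, ← sum_correctSum i₀ p]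
      refine (dist_sum_sum_le_of_le _ fun i _ => hi i).trans (by simp)
  refine (measure_mono hsub).trans ?_
  rw [Measure.prod_prod]
  refine mul_le_mul' ?_ (hν _)
  rw [volume_pi_pi, ← Finset.mul_prod_erase _ _ (Finset.mem_univ i₀)]
  rw [if_pos rfl, measure_univ, one_mul]
  rw [Finset.prod_congr rfl fun i hi => by rw [if_neg (Finset.ne_of_mem_erase hi)],
    ← Finset.card_univ, ← Finset.card_erase_of_mem (Finset.mem_univ i₀)]
  refine Finset.prod_le_pow_card _ _ _ fun i _ => ?_
  rw [AddCircle.volume_closedBall]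
  exact ENNReal.ofReal_le_ofReal (min_le_right _ _)

end Torus

/-! ### The dimensions of the supports -/

lemma prescribedSumMeasure_mem {d : ℕ} (i₀ : Fin d) (ν : Measure UnitAddCircle)
    [IsProbabilityMeasure ν] : prescribedSumMeasure i₀ ν ∈ uniformMarginalMeasures d := by
  refine ⟨inferInstance, prescribedSumMeasure_compl_unitCube i₀ ν, fun j => ?_⟩
  have hdrop : Measurable (dropCoord j) := by unfold dropCoord; fun_prop
  have hc : Measurable fun (p : (Fin d → UnitAddCircle) × UnitAddCircle) (k : {k // k ≠ j}) =>
      correctSum i₀ p k :=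
    (continuous_pi fun k : {k // k ≠ j} =>
      (continuous_apply (k : Fin d)).comp (continuous_correctSum i₀)).measurable
  rw [prescribedSumMeasure, Measure.map_map hdrop (measurable_torusLift_correctSum i₀),
    ← measurePreserving_torusLift.map_eq, ← map_correctSum_dropped i₀ j ν,
    Measure.map_map measurePreserving_torusLift.measurable hc]
  rfl

lemma dimH_support_prescribedSumMeasure_le {d : ℕ} (i₀ : Fin d) {k m : ℕ} [NeZero k] (h : k ≤ m)
    (hm : 2 ≤ m) {s : ℝ} (hs : 0 ≤ s) (hks : (k : ℝ) = (m : ℝ) ^ s) :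
    dimH (prescribedSumMeasure i₀ (cantorCircleMeasure h)).support ≤
      ENNReal.ofReal ((d - 1 : ℕ) + s) := by
  have h1 := dimH_cube_prod_cantor_le (ι := {k : Fin d // k ≠ i₀}) h hm hs hks
  have hcard : Fintype.card {k : Fin d // k ≠ i₀} = d - 1 := by simp
  rw [hcard] at h1
  refine le_trans (dimH_mono ?_) (dimH_sum_mem_le i₀ h1)
  have hK : IsClosed ((fun c : ℝ => (c : UnitAddCircle)) '' range (cantorPoint h)) := by
    rw [← range_comp]
    exact (isCompact_range (continuous_coe_cantorPoint h)).isClosed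
  refine Measure.support_subset_of_isClosed (isClosed_unitCube.inter (isClosed_sum_mem hK)) ?_
  refine Filter.inter_mem (prescribedSumMeasure_compl_unitCube i₀ _)
    (prescribedSumMeasure_sum_notMem i₀ _ hK ?_)
  rw [cantorCircleMeasure, Measure.map_apply (continuous_coe_cantorPoint h).measurable
    hK.measurableSet.compl]
  rw [preimage_compl, preimage_eq_univ_iff.2 (range_subset_iff.2 fun a =>
    mem_image_of_mem _ (mem_range_self a)), compl_univ, measure_empty]

lemma le_dimH_support_prescribedSumMeasure {d : ℕ} (hd : 2 ≤ d) (i₀ : Fin d) {k m : ℕ} [NeZero k]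
    (h : k ≤ m) (hkm : 2 * k ≤ m) {s : ℝ} (hs : 0 ≤ s) (hks : (k : ℝ) = (m : ℝ) ^ s) :
    ENNReal.ofReal ((d - 1 : ℕ) + s) ≤
      dimH (prescribedSumMeasure i₀ (cantorCircleMeasure h)).support := by
  have hk : 0 < k := NeZero.pos k
  have hm : 2 ≤ m := by omega
  have hm0 : (0 : ℝ) < m := by positivity
  have hd0 : (0 : ℝ) < d := by positivity
  have hd1 : (0 : ℝ) < (d - 1 : ℕ) := by
    have : 0 < d - 1 := by omega
    exact_mod_cast this
  -- With `δ = c / m ^ n` and `c = 1 / (8 * d)`, twice the radius `d * δ` is `1 / (4 * m ^ n)`,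
  -- below the cylinder separation `1 / (2 * m ^ n)`; also `2 * δ ≤ 1 / m ^ n`.
  refine le_dimH_of_measure_le_geometric (prescribedSumMeasure i₀ (cantorCircleMeasure h))
    (b := m) (c := 1 / (8 * d)) (by exact_mod_cast hm) (by positivity) (by positivity)
    (fun n U hU hUd => ?_) ?_
  · refine (prescribedSumMeasure_le i₀ (cantorCircleMeasure h) (by positivity) (fun v =>
      cantorCircleMeasure_closedBall_le h hkm n v ?_) hU hUd).trans ?_
    · rw [Fintype.card_fin, lt_inv_comm₀ (by positivity) (by positivity)]
      rw [show (2 * (d * (1 / (8 * d) / (m : ℝ) ^ n)) : ℝ) = (4 * (m : ℝ) ^ n)⁻¹ by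
        field_simp; norm_num]
      rw [inv_inv]
      have : (0 : ℝ) < m ^ n := by positivity
      linarith
    · rw [Fintype.card_fin, ← ENNReal.ofReal_pow (by positivity), ← ENNReal.ofReal_natCast k,
        ← ENNReal.ofReal_inv_of_pos (by exact_mod_cast hk), ← ENNReal.ofReal_pow (by positivity),
        ← ENNReal.ofReal_mul (by positivity)]
      refine ENNReal.ofReal_le_ofReal ?_
      rw [Real.rpow_add (by positivity), Real.rpow_natCast]
      have h2 : ((k : ℝ)⁻¹) ^ n = (((m : ℝ) ^ n)⁻¹) ^ s := by
        rw [hks, Real.inv_rpow (by positivity), inv_pow, ← Real.rpow_natCast (_ ^ s),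
          ← Real.rpow_natCast (m : ℝ) n, ← Real.rpow_mul hm0.le, ← Real.rpow_mul hm0.le, mul_comm s]
      rw [h2]
      gcongr
      rw [div_div, mul_one_div, ← one_div]
      rw [div_le_div_iff₀ (by positivity) (by positivity)]
      have : (0 : ℝ) < m ^ n := by positivity
      have : (1 : ℝ) ≤ d := by exact_mod_cast (by omega : 1 ≤ d)
      nlinarith
  · rw [(prob_compl_eq_zero_iff₀ Measure.nullMeasurableSet_support).1
      Measure.measure_compl_support]
    exact one_ne_zero

/-- The support carries full mass, so its projection cannot be Lebesgue-null, and a smooth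
projection does not raise dimension. -/
lemma le_dimH_support_of_mem {d : ℕ} {μ : Measure (EuclideanSpace ℝ (Fin d))} (j : Fin d)
    (hμ : μ ∈ uniformMarginalMeasures d) : ((d - 1 : ℕ) : ℝ≥0∞) ≤ dimH μ.support := by
  obtain ⟨hprob, -, hmarg⟩ := hμ
  have hdrop : Measurable (dropCoord j) := by unfold dropCoord; fun_prop
  -- The target carries the sup metric, for which Hausdorff measure in the full dimension is
  -- Lebesgue measure.
  let f : EuclideanSpace ℝ (Fin d) → {k : Fin d // k ≠ j} → ℝ := fun x k => x k
  have hf : ContDiff ℝ 1 f := by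
    refine contDiff_pi.2 fun k => ?_
    fun_prop
  have hvol : (volume : Measure ({k : Fin d // k ≠ j} → ℝ)) (f '' μ.support) ≠ 0 := by
    intro h0
    have h1 : volume (WithLp.toLp 2 '' (f '' μ.support) :
        Set (EuclideanSpace ℝ {k : Fin d // k ≠ j})) = 0 := by
      have hmp := (PiLp.volume_preserving_ofLp {k : Fin d // k ≠ j})
      have := hmp.quasiMeasurePreserving.preimage_null h0
      convert this using 2
      ext x
      constructor
      · rintro ⟨y, hy, rfl⟩; exact hy
      · intro hx; exact ⟨_, hx, rfl⟩
    have h2 : μ.map (dropCoord j) (WithLp.toLp 2 '' (f '' μ.support)) = 0 := by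
      rw [hmarg j]
      exact Measure.absolutelyContinuous_of_le Measure.restrict_le_self h1
    -- The projected set is not known to be measurable; the inequality for push-forwards holds for
    -- all sets.
    have h3 := nonpos_iff_eq_zero.1 ((Measure.le_map_apply hdrop.aemeasurable _).trans h2.le)
    have h4 : μ μ.support = 0 :=
      measure_mono_null (t := dropCoord j ⁻¹' (WithLp.toLp 2 '' (f '' μ.support)))
        (fun x hx => ⟨f x, mem_image_of_mem f hx, rfl⟩) h3
    have h5 : μ univ = 0 := by
      rw [← union_compl_self μ.support]
      exact measure_union_null h4 Measure.measure_compl_support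
    simp at h5
  rw [← hausdorffMeasure_pi_real] at hvol
  have hcard : Fintype.card {k : Fin d // k ≠ j} = d - 1 := by simp
  rw [hcard] at hvol
  have h6 : (((d - 1 : ℕ) : NNReal) : ℝ≥0∞) ≤ dimH (f '' μ.support) :=
    le_dimH_of_hausdorffMeasure_ne_zero (by rw [NNReal.coe_natCast]; exact hvol)
  simp only [ENNReal.coe_natCast] at h6
  exact h6.trans (hf.contDiffOn.dimH_image_le convex_univ (subset_univ _))

/-- For `r = p / q` take `k = 2 ^ p` and `m = 2 ^ q`; then `k = m ^ r`, and `p < q` gives `2 * k ≤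
m`. -/
lemma ofReal_add_ratCast_mem_supportDimensions {d : ℕ} (hd : 2 ≤ d) {r : ℚ} (h0 : 0 < r)
    (h1 : r < 1) : ENNReal.ofReal ((d - 1 : ℕ) + (r : ℝ)) ∈ supportDimensions d := by
  let i₀ : Fin d := ⟨0, by omega⟩
  obtain ⟨p, hp⟩ := Int.eq_ofNat_of_zero_le (Rat.num_nonneg.2 h0.le)
  have hpq : p < r.den := by
    have := Rat.num_lt_denom_iff.2 h1
    omega
  have hr : (r : ℝ) = p / r.den := by
    conv_lhs => rw [← Rat.num_div_den r, hp]
    simp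
  have hkm : 2 * 2 ^ p ≤ 2 ^ r.den := by
    rw [← pow_succ']
    exact Nat.pow_le_pow_right (by norm_num) hpq
  have hle : 2 ^ p ≤ 2 ^ r.den := by omega
  have hm : 2 ≤ 2 ^ r.den := by have := Nat.one_le_two_pow (n := p); omega
  have hks : ((2 ^ p : ℕ) : ℝ) = ((2 ^ r.den : ℕ) : ℝ) ^ (r : ℝ) := by
    have hden : (r.den : ℝ) ≠ 0 := by exact_mod_cast r.den_ne_zero
    push_cast
    rw [← Real.rpow_natCast 2 r.den, ← Real.rpow_mul (by norm_num), hr, mul_div_cancel₀ _ hden,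
      Real.rpow_natCast]
  have hs : (0 : ℝ) ≤ r := by exact_mod_cast h0.le
  exact ⟨prescribedSumMeasure i₀ (cantorCircleMeasure hle), prescribedSumMeasure_mem i₀ _,
    le_antisymm (dimH_support_prescribedSumMeasure_le i₀ hle hm hs hks)
      (le_dimH_support_prescribedSumMeasure hd i₀ hle hkm hs hks)⟩

/-- For `d ≥ 3`, the set of Hausdorff dimensions of supports of probability measures on `[0,1]^d`
with uniform `(d-1)`-dimensional marginals is a dense subset of `[d-1, d]`. -/
theorem theorem5p2 (d : ℕ) (hd : 3 ≤ d) :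
    supportDimensions d ⊆ Icc ((d - 1 : ℕ) : ℝ≥0∞) (d : ℝ≥0∞) ∧
      Icc ((d - 1 : ℕ) : ℝ≥0∞) (d : ℝ≥0∞) ⊆ closure (supportDimensions d) := by
  constructor
  · rintro _ ⟨μ, hμ, rfl⟩
    refine ⟨le_dimH_support_of_mem ⟨0, by omega⟩ hμ, ?_⟩
    refine (dimH_mono (subset_univ _)).trans ?_
    rw [Real.dimH_univ_eq_finrank, finrank_euclideanSpace, Fintype.card_fin]
  · intro x hx
    have hxtop : x ≠ ⊤ := (hx.2.trans_lt (ENNReal.natCast_lt_top d)).ne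
    obtain ⟨y, hy0, rfl⟩ : ∃ y : ℝ, 0 ≤ y ∧ x = ENNReal.ofReal y :=
      ⟨_, ENNReal.toReal_nonneg, (ENNReal.ofReal_toReal hxtop).symm⟩
    have hyl : ((d - 1 : ℕ) : ℝ) ≤ y := by
      have := hx.1
      rwa [← ENNReal.ofReal_natCast, ENNReal.ofReal_le_ofReal_iff hy0] at this
    have hyu : y ≤ d := by
      have := hx.2
      rwa [← ENNReal.ofReal_natCast, ENNReal.ofReal_le_ofReal_iff (by positivity)] at this
    have hd' : ((d - 1 : ℕ) : ℝ) = d - 1 := by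
      rw [Nat.cast_sub (by omega), Nat.cast_one]
    let f : ℝ → ℝ≥0∞ := fun z => ENNReal.ofReal ((d - 1 : ℕ) + z)
    have hf : Continuous f := ENNReal.continuous_ofReal.comp (by fun_prop)
    -- Rationals of the open interval suffice: the endpoints `d - 1` and `d` are reached as limits.
    have hz : y - (d - 1 : ℕ) ∈ closure (Ioo (0 : ℝ) 1 ∩ range ((↑) : ℚ → ℝ)) := by
      refine closure_minimal (Rat.isDenseEmbedding_coe_real.dense.open_subset_closure_inter
        isOpen_Ioo) isClosed_closure ?_
      rw [closure_Ioo zero_ne_one]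
      constructor <;> linarith
    have hmem := image_closure_subset_closure_image hf (mem_image_of_mem f hz)
    rw [show f (y - (d - 1 : ℕ)) = ENNReal.ofReal y by simp [f]] at hmem
    refine closure_mono ?_ hmem
    rintro _ ⟨_, ⟨hr, r, rfl⟩, rfl⟩
    exact ofReal_add_ratCast_mem_supportDimensions (by omega) (by exact_mod_cast hr.1)
      (by exact_mod_cast hr.2)
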